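/- Let $N\ge3$ players, labelled $1,\dots,N$ modulo $N$, sit in a circle, each being a loser ($0$) or a winner ($1$), and let $x\in\Sigma:=\{0,1\}^N$ be the vector of statuses. For parameters $p=(p_0,p_1,p_2,p_3)\in[0,1]^4$, at each turn a uniformly chosen player $i$ tosses a coin with probability of heads $p_{m_i(x)}$, where $m_i(x)=2x_{i-1}+x_{i+1}$; with heads he wins one unit and his status becomes $1$, with tails he loses one unit and his status becomes $0$. Let $P_p$ be the resulting one-step transition matrix on $\Sigma$. Let $\{(X(n),I(n))\}_{n\ge0}$ be the Markov chain in $\Sigma\times\{1,\dots,N\}$ that records the statuses and the next player to play (uniformly chosen at each step), with arbitrary initial distribution, and let $S_n$ be the total profit of the $N$ players after $n$ turns. The mean profit per turn $\mu^N(p)$ is the real number, if there is one, such that $S_n/n\to\mu^N(p)$ almost surely for every initial distribution. Let $p_0=1$, $p_1=p_2\in(1/2,1)$, $p_3=0$. Put $\mu_B^N:=\mu^N(p_0,p_1,p_2,p_3)$ and $\mu_C^N:=\mu^N(p^C)$ with $p^C_m:=(1/2+p_m)/2$ for $m=0,1,2,3$ (at each turn a fair coin decides whether game $B$ or a fair coin-tossing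 game is played). Then, for every $N\ge 3$, $\mu_B^N$ and $\mu_C^N$ exist, and (a) $\mu_B^N=0$ if $N$ is even; (b) $\mu_B^N=(p_1+p_2-1)/N>0$ if $N$ is odd; (c) $P_{p^C}$ has a unique stationary distribution $\pi$ on $\Sigma$, and $\mu_C^N=\tfrac23(2p_1-1)\,\pi_{1,3}(0,1)>0$, where $\pi_{1,3}(0,1):=\pi\{x: x_1=0,\ x_3=1\}$. In particular, the Parrondo effect (that is, $\mu_B^N\le0$ and $\mu_C^N>0$) is present if and only if $N$ is even. -/

import Mathlib

open Filter Topology MeasureTheory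

namespace Parrondo

/-- Status (0 = loser, 1 = winner) of each of the `N` players on the circle; player `i`
(`1 ≤ i ≤ N`) is labelled by the residue of `i` modulo `N`. -/
abbrev State (N : ℕ) : Type := ZMod N → Fin 2

/-- State of the more informative chain: the statuses, and the next player to play. -/
abbrev StarState (N : ℕ) : Type := State N × ZMod N

/-- `m_i(x) = 2 x_{i-1} + x_{i+1}`. -/
def nbr {N : ℕ} (x : State N) (i : ZMod N) : Fin 4 :=
  ⟨2 * (x (i - 1)).val + (x (i + 1)).val, by omega⟩

/-- The state `x^i`, equal to `x` except at the `i`th component. -/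
def flip {N : ℕ} (x : State N) (i : ZMod N) : State N :=
  Function.update x i (1 - x i)

noncomputable section

/-- Probability that the status of player `i` changes when he plays in state `x`. -/
def changeProb {N : ℕ} (p : Fin 4 → ℝ) (x : State N) (i : ZMod N) : ℝ :=
  if x i = 0 then p (nbr x i) else 1 - p (nbr x i)

/-- Probability that the status of player `i` does not change when he plays in state `x`. -/
def stayProb {N : ℕ} (p : Fin 4 → ℝ) (x : State N) (i : ZMod N) : ℝ :=
  if x i = 0 then 1 - p (nbr x i) else p (nbr x i)

/-- One-step transition matrix on `{0,1}^N`. -/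
def P (N : ℕ) [NeZero N] (p : Fin 4 → ℝ) : Matrix (State N) (State N) ℝ := fun x y =>
  (N : ℝ)⁻¹ * ∑ i : ZMod N,
    ((if y = flip x i then changeProb p x i else 0) + (if y = x then stayProb p x i else 0))

/-- One-step transition matrix on `{0,1}^N × {1,…,N}`. -/
def PStar (N : ℕ) [NeZero N] (p : Fin 4 → ℝ) : Matrix (StarState N) (StarState N) ℝ :=
  fun z w =>
    (N : ℝ)⁻¹ *
      ((if w.1 = flip z.1 z.2 then changeProb p z.1 z.2 else 0) +
        (if w.1 = z.1 then stayProb p z.1 z.2 else 0))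

/-- `π` is a stationary distribution of the transition matrix `Q`. -/
structure IsStationary {S : Type*} [Fintype S] (Q : Matrix S S ℝ) (π : S → ℝ) : Prop where
  nonneg : ∀ x, 0 ≤ π x
  sum_eq_one : ∑ x, π x = 1
  stationary : Matrix.vecMul π Q = π

/-- The two-dimensional marginal `π_{1,3}(u,v)` of a distribution `π` on `{0,1}^N`. -/
def marginal13 {N : ℕ} [NeZero N] (π : State N → ℝ) (u v : Fin 2) : ℝ :=
  ∑ x : State N, if x 1 = u ∧ x 3 = v then π x else 0

/-- `Z` is a time-homogeneous Markov chain with transition matrix `Q`, with an arbitrary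
initial distribution, on the probability space `(Ω, ℙ)`. -/
structure IsMarkovChain {S Ω : Type*} [MeasurableSpace Ω] (ℙ : Measure Ω)
    (Q : Matrix S S ℝ) (Z : ℕ → Ω → S) : Prop where
  measurableSet_fiber : ∀ n s, MeasurableSet {ω | Z n ω = s}
  law : ∀ (n : ℕ) (z : ℕ → S),
    ℙ.real {ω | ∀ k ≤ n, Z k ω = z k} =
      ℙ.real {ω | Z 0 ω = z 0} * ∏ k ∈ Finset.range n, Q (z k) (z (k + 1))

/-- Profit of a turn that leads from `z = (x, i)` to `w = (y, j)`: player `i` has played, and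
he has won one unit if he is a winner now and lost one unit if he is a loser now. -/
def payoff {N : ℕ} (z w : StarState N) : ℝ := if w.1 z.2 = 1 then 1 else -1

/-- Total profit of the `N` players after `n` turns. -/
def totalProfit {N : ℕ} {Ω : Type*} (Z : ℕ → Ω → StarState N) (n : ℕ) (ω : Ω) : ℝ :=
  ∑ k ∈ Finset.range n, payoff (Z k ω) (Z (k + 1) ω)

/-- `μ` is the mean profit per turn to the ensemble of `N` players of the game with probability
parameters `p`: for every initial distribution, the profit per turn up to time `n` converges
to `μ` almost surely. -/
def IsMeanProfit (N : ℕ) [NeZero N] (p : Fin 4 → ℝ) (μ : ℝ) : Prop :=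
  ∀ (Ω : Type) [MeasurableSpace Ω] (ℙ : Measure Ω) [IsProbabilityMeasure ℙ]
    (Z : ℕ → Ω → StarState N), IsMarkovChain ℙ (PStar N p) Z →
      ∀ᵐ ω ∂ℙ, Tendsto (fun n : ℕ => totalProfit Z n ω / n) atTop (𝓝 μ)

/-- Parameters of game `C = (A + B) / 2`, where `B` has parameters `p` and `A` is fair. -/
def gameC (p : Fin 4 → ℝ) : Fin 4 → ℝ := fun m => (1 / 2 + p m) / 2

/-- The Parrondo effect: game `B` is losing or fair, and game `C` is winning. -/
def ParrondoEffect (N : ℕ) [NeZero N] (p : Fin 4 → ℝ) : Prop :=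
  ∃ μB μC : ℝ, IsMeanProfit N p μB ∧ IsMeanProfit N (gameC p) μC ∧ μB ≤ 0 ∧ 0 < μC

end

end Parrondo

namespace Parrondo

/-! ### Strong law for martingale increments along a finite Markov chain. -/

section StrongLaw

variable {S Ω : Type*} [MeasurableSpace Ω] {ℙ : Measure Ω} {Q : Matrix S S ℝ}
  {Z : ℕ → Ω → S}

/-! Write `q` for `p₁ = p₂`. Everything rests on the Poisson equation `f = g - μ + P f`, where `g`
is the expected profit of one turn. Given a solution, the total profit minus `n μ` is, up to a
bounded telescoping term, a sum of martingale differences. The strong law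
`IsMarkovChain.ae_tendsto_div` makes that sum `o(n)`, whatever the initial law
(`isMeanProfit_of_poisson`). Solutions come from linear algebra: the maximum principle makes a
Dirichlet problem injective, hence solvable in finite dimension. Uniqueness of `μ` also requires
that some chain exists (`exists_isMarkovChain`).

Game `B`: call an edge of the circle a defect if its ends have equal status. A player who differs
from both neighbours never changes status, so defects move or annihilate in pairs but are never
created, and their number has the parity of `N`. The states with at most one defect form a closed
set reachable from everywhere. Removing from the mean payoff the drift of the number of winners,
which does not affect `μ`, leaves a source that on this set equals `(2q - 1)/N` times the number of
defects (`sum_of_card_defects_le_one`). That number is 0 or 1 according to the parity of `N`.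

Game `C`: all coins are nondegenerate, so the stationary law is unique, hence rotation invariant,
and positive everywhere. If `a` is the density of winners and `m` the mass of the pattern `0 · 1`,
the mean probability of heads is `3/4 - a/2 + (q - 1/2) m`. Zero drift equates it with `a`, so the
mean profit `2a - 1` is `(2/3)(2q - 1) m` (`sum_mul_meanPayoff_gameC`). -/

lemma IsMarkovChain.measurableSet_path (h : IsMarkovChain ℙ Q Z) (n : ℕ) (z : Fin n → S) :
    MeasurableSet {ω | (fun k : Fin n => Z k ω) = z} := by
  have : {ω | (fun k : Fin n => Z k ω) = z} = ⋂ k : Fin n, {ω | Z k ω = z k} := by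
    ext ω
    simp [funext_iff]
  rw [this]
  exact MeasurableSet.iInter fun k => h.measurableSet_fiber k (z k)

/-- The Markov property along finite paths. -/
lemma IsMarkovChain.real_path_snoc (h : IsMarkovChain ℙ Q Z) (n : ℕ) (z : Fin (n + 1) → S)
    (w : S) :
    ℙ.real {ω | (fun k : Fin (n + 2) => Z k ω) = (Fin.snoc z w : Fin (n + 2) → S)} =
      ℙ.real {ω | (fun k : Fin (n + 1) => Z k ω) = z} * Q (z (Fin.last n)) w := by
  let ζ : ℕ → S := fun k => if hk : k < n + 1 then z ⟨k, hk⟩ else w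
  have hζ : ∀ k (hk : k < n + 1), ζ k = z ⟨k, hk⟩ := fun k hk => dif_pos hk
  have hζ' : ζ (n + 1) = w := dif_neg (lt_irrefl _)
  have hsnoc : ∀ k (hk : k < n + 2), (Fin.snoc z w : Fin (n + 2) → S) ⟨k, hk⟩ = ζ k := by
    intro k hk
    rcases Nat.lt_or_ge k (n + 1) with hk' | hk'
    · rw [hζ k hk']
      simp [Fin.snoc, hk']
    · obtain rfl : k = n + 1 := by lia
      rw [hζ']
      simp [Fin.snoc]
  have h1 : {ω | (fun k : Fin (n + 1) => Z k ω) = z} = {ω | ∀ k ≤ n, Z k ω = ζ k} := by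
    ext ω
    simp only [Set.mem_ofPred_eq, funext_iff, Fin.forall_iff]
    exact forall_congr' fun k => ⟨fun H hk => by rw [hζ k (by lia)]; exact H (by lia),
      fun H hk => by rw [← hζ k hk]; exact H (by lia)⟩
  have h2 : {ω | (fun k : Fin (n + 2) => Z k ω) = (Fin.snoc z w : Fin (n + 2) → S)} =
      {ω | ∀ k ≤ n + 1, Z k ω = ζ k} := by
    ext ω
    simp only [Set.mem_ofPred_eq, funext_iff, Fin.forall_iff]
    exact forall_congr' fun k => ⟨fun H hk => by rw [← hsnoc k (by lia)]; exact H (by lia),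
      fun H hk => by rw [hsnoc k hk]; exact H (by lia)⟩
  rw [h1, h2, h.law, h.law, Finset.prod_range_succ, hζ', hζ n n.lt_succ_self, mul_assoc]
  rfl

variable [Fintype S]

lemma IsMarkovChain.measurable_path (h : IsMarkovChain ℙ Q Z) (n : ℕ)
    (G : (Fin n → S) → ℝ) : Measurable fun ω => G fun k => Z k ω := by
  classical
  have : (fun ω => G fun k => Z k ω) = fun ω => ∑ z : Fin n → S,
      Set.indicator {ω | (fun k : Fin n => Z k ω) = z} (fun _ => G z) ω := by
    ext ω
    simp [Set.indicator_apply]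
  rw [this]
  exact Finset.measurable_sum _ fun z _ => measurable_const.indicator (h.measurableSet_path n z)

lemma IsMarkovChain.integrable_path [IsProbabilityMeasure ℙ] (h : IsMarkovChain ℙ Q Z) (n : ℕ)
    (G : (Fin n → S) → ℝ) : Integrable (fun ω => G fun k => Z k ω) ℙ := by
  refine Integrable.of_bound (h.measurable_path n G).aestronglyMeasurable (∑ z, ‖G z‖)
    (ae_of_all _ fun ω => ?_)
  exact Finset.single_le_sum (f := fun z => ‖G z‖) (fun z _ => norm_nonneg _)
    (Finset.mem_univ _)

lemma IsMarkovChain.integral_path [IsProbabilityMeasure ℙ] (h : IsMarkovChain ℙ Q Z) (n : ℕ)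
    (G : (Fin n → S) → ℝ) :
    ∫ ω, G (fun k => Z k ω) ∂ℙ =
      ∑ z : Fin n → S, ℙ.real {ω | (fun k : Fin n => Z k ω) = z} * G z := by
  classical
  have : (fun ω => G fun k => Z k ω) = fun ω => ∑ z : Fin n → S,
      Set.indicator {ω | (fun k : Fin n => Z k ω) = z} (fun _ => G z) ω := by
    ext ω
    simp [Set.indicator_apply]
  rw [this, integral_finsetSum]
  · refine Finset.sum_congr rfl fun z _ => ?_
    rw [integral_indicator_const _ (h.measurableSet_path n z), smul_eq_mul]
  · exact fun z _ => (integrable_const _).indicator (h.measurableSet_path n z)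

/-- A function of a transition with vanishing conditional mean is orthogonal to the past. -/
lemma IsMarkovChain.integral_mul_eq_zero [IsProbabilityMeasure ℙ] (h : IsMarkovChain ℙ Q Z)
    {φ : S → S → ℝ} (hφ : ∀ s, ∑ w, Q s w * φ s w = 0) (n : ℕ) (G : (Fin (n + 1) → S) → ℝ) :
    ∫ ω, G (fun k => Z k ω) * φ (Z n ω) (Z (n + 1) ω) ∂ℙ = 0 := by
  have := h.integral_path (n + 2) (fun z => G (Fin.init z) *
    φ (z (Fin.last n).castSucc) (z (Fin.last (n + 1))))
  refine Eq.trans this ?_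
  -- Split off the last state of the path: summing over it first produces the conditional mean of
  -- `φ`, which vanishes.
  rw [← (Fin.snocEquiv fun _ : Fin (n + 2) => S).sum_comp, Fintype.sum_prod_type,
    Finset.sum_comm]
  refine Finset.sum_eq_zero fun z _ => ?_
  have : ∀ w, ℙ.real {ω | (fun k : Fin (n + 2) => Z k ω) =
      (Fin.snocEquiv fun _ : Fin (n + 2) => S) (w, z)} * (G (Fin.init
        ((Fin.snocEquiv fun _ : Fin (n + 2) => S) (w, z))) *
        φ ((Fin.snocEquiv fun _ : Fin (n + 2) => S) (w, z) (Fin.last n).castSucc)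
          ((Fin.snocEquiv fun _ : Fin (n + 2) => S) (w, z) (Fin.last (n + 1)))) =
      ℙ.real {ω | (fun k : Fin (n + 1) => Z k ω) = z} * G z *
        (Q (z (Fin.last n)) w * φ (z (Fin.last n)) w) := by
    intro w
    have e : (Fin.snocEquiv fun _ : Fin (n + 2) => S) (w, z) = Fin.snoc z w := rfl
    rw [e, h.real_path_snoc, Fin.init_snoc, Fin.snoc_castSucc, Fin.snoc_last]
    ring
  simp_rw [this]
  rw [← Finset.mul_sum, hφ, mul_zero]

/-- Second moment bound for the martingale of centred increments. -/
lemma IsMarkovChain.integral_sq_le [IsProbabilityMeasure ℙ] (h : IsMarkovChain ℙ Q Z)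
    {φ : S → S → ℝ} (hφ : ∀ s, ∑ w, Q s w * φ s w = 0) {C : ℝ} (hC : ∀ s w, |φ s w| ≤ C)
    (n : ℕ) :
    ∫ ω, (∑ k ∈ Finset.range n, φ (Z k ω) (Z (k + 1) ω)) ^ 2 ∂ℙ ≤ n * C ^ 2 := by
  have hG : ∀ (n : ℕ) ω, ∑ k ∈ Finset.range n, φ (Z k ω) (Z (k + 1) ω) =
      (fun z : Fin (n + 1) → S => ∑ k : Fin n, φ (z k.castSucc) (z k.succ)) fun k => Z k ω :=
    fun n ω => by
      simp [Finset.sum_range]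
  induction n with
  | zero => simp
  | succ n ih =>
    have hint1 : Integrable (fun ω => (∑ k ∈ Finset.range n, φ (Z k ω) (Z (k + 1) ω)) ^ 2) ℙ := by
      simp_rw [hG]
      exact h.integrable_path (n + 1) fun z =>
        (∑ k : Fin n, φ (z k.castSucc) (z k.succ)) ^ 2
    have hint2 : Integrable (fun ω => (∑ k ∈ Finset.range n, φ (Z k ω) (Z (k + 1) ω)) *
        φ (Z n ω) (Z (n + 1) ω)) ℙ := by
      simp_rw [hG]
      exact h.integrable_path (n + 2) fun z =>
        (∑ k : Fin n, φ (z k.castSucc.castSucc) (z k.succ.castSucc)) *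
          φ (z (Fin.last n).castSucc) (z (Fin.last (n + 1)))
    have hint3 : Integrable (fun ω => φ (Z n ω) (Z (n + 1) ω) ^ 2) ℙ :=
      h.integrable_path (n + 2) fun z =>
          φ (z (Fin.last n).castSucc) (z (Fin.last (n + 1))) ^ 2
    have hzero : ∫ ω, (∑ k ∈ Finset.range n, φ (Z k ω) (Z (k + 1) ω)) *
        φ (Z n ω) (Z (n + 1) ω) ∂ℙ = 0 := by
      simp_rw [hG]
      exact h.integral_mul_eq_zero hφ n
        (fun z : Fin (n + 1) → S => ∑ k : Fin n, φ (z k.castSucc) (z k.succ))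
    have hlast : ∫ ω, φ (Z n ω) (Z (n + 1) ω) ^ 2 ∂ℙ ≤ C ^ 2 := by
      have := integral_mono hint3 (integrable_const (C ^ 2)) fun ω =>
        sq_le_sq' (abs_le.1 (hC (Z n ω) (Z (n + 1) ω))).1 (abs_le.1 (hC (Z n ω) (Z (n + 1) ω))).2
      simpa using this
    have hexp : ∀ ω, (∑ k ∈ Finset.range (n + 1), φ (Z k ω) (Z (k + 1) ω)) ^ 2 =
        (∑ k ∈ Finset.range n, φ (Z k ω) (Z (k + 1) ω)) ^ 2 +
          2 * ((∑ k ∈ Finset.range n, φ (Z k ω) (Z (k + 1) ω)) * φ (Z n ω) (Z (n + 1) ω)) +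
          φ (Z n ω) (Z (n + 1) ω) ^ 2 := fun ω => by
      rw [Finset.sum_range_succ]
      ring
    have hint12 : Integrable (fun ω => (∑ k ∈ Finset.range n, φ (Z k ω) (Z (k + 1) ω)) ^ 2 +
        2 * ((∑ k ∈ Finset.range n, φ (Z k ω) (Z (k + 1) ω)) * φ (Z n ω) (Z (n + 1) ω))) ℙ :=
      hint1.add (hint2.const_mul 2)
    simp_rw [hexp]
    rw [integral_add hint12 hint3,
      integral_add hint1 (hint2.const_mul 2), integral_const_mul, hzero]
    push_cast
    linarith

/-- Strong law of large numbers for centred functions of the transitions of a finite chain. -/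
lemma IsMarkovChain.ae_tendsto_div [IsProbabilityMeasure ℙ] (h : IsMarkovChain ℙ Q Z)
    {φ : S → S → ℝ} (hφ : ∀ s, ∑ w, Q s w * φ s w = 0) :
    ∀ᵐ ω ∂ℙ, Tendsto (fun n : ℕ => (∑ k ∈ Finset.range n, φ (Z k ω) (Z (k + 1) ω)) / n)
      atTop (𝓝 0) := by
  obtain ⟨C, hC⟩ : ∃ C, ∀ s w, |φ s w| ≤ C :=
    ⟨∑ s, ∑ w, |φ s w|, fun s w =>
      (Finset.single_le_sum (f := fun w => |φ s w|) (fun _ _ => abs_nonneg _)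
        (Finset.mem_univ w)).trans
      (Finset.single_le_sum (f := fun s => ∑ w, |φ s w|)
        (fun _ _ => Finset.sum_nonneg fun _ _ => abs_nonneg _) (Finset.mem_univ s))⟩
  set M : ℕ → Ω → ℝ := fun n ω => ∑ k ∈ Finset.range n, φ (Z k ω) (Z (k + 1) ω) with hM
  have hMpath : ∀ (n : ℕ) (ω : Ω), M n ω =
      (fun z : Fin (n + 1) → S => ∑ k : Fin n, φ (z k.castSucc) (z k.succ)) fun k => Z k ω :=
    fun n ω => by
      simp [hM, Finset.sum_range]
  -- Along the squares the second moments are at most `C² / n²`, hence summable, so `Y n → 0` almost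
  -- surely.
  let Y : ℕ → Ω → ℝ := fun n ω => (M (n ^ 2) ω / (n ^ 2 : ℕ)) ^ 2
  have hYm : ∀ n, Measurable (Y n) := fun n => by
    simp only [Y, hMpath]
    exact h.measurable_path _ fun z : Fin (n ^ 2 + 1) → S =>
      ((∑ k : Fin (n ^ 2), φ (z k.castSucc) (z k.succ)) / (n ^ 2 : ℕ)) ^ 2
  have hYi : ∀ n, Integrable (Y n) ℙ := fun n => by
    simp only [Y, hMpath]
    exact h.integrable_path _ fun z : Fin (n ^ 2 + 1) → S =>
      ((∑ k : Fin (n ^ 2), φ (z k.castSucc) (z k.succ)) / (n ^ 2 : ℕ)) ^ 2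
  have hYint : ∀ n, ∫ ω, Y n ω ∂ℙ ≤ C ^ 2 * (1 / (n : ℝ) ^ 2) := fun n => by
    rcases Nat.eq_zero_or_pos n with rfl | hn
    · simp [Y, hM]
    have hn' : (0 : ℝ) < n := by exact_mod_cast hn
    simp only [Y, div_pow]
    rw [integral_div, div_le_iff₀ (by positivity)]
    refine (h.integral_sq_le hφ hC (n ^ 2)).trans (le_of_eq ?_)
    push_cast
    field_simp
  have hsum : ∑' n, ∫⁻ ω, ENNReal.ofReal (Y n ω) ∂ℙ ≠ ⊤ := by
    have hs : Summable fun n : ℕ => C ^ 2 * (1 / (n : ℝ) ^ 2) :=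
      (Real.summable_one_div_nat_pow.2 one_lt_two).mul_left _
    refine ne_top_of_le_ne_top hs.tsum_ofReal_ne_top (ENNReal.tsum_le_tsum fun n => ?_)
    rw [← ofReal_integral_eq_lintegral_ofReal (hYi n) (ae_of_all _ fun ω => sq_nonneg _)]
    exact ENNReal.ofReal_le_ofReal (hYint n)
  rw [← lintegral_tsum fun n => (hYm n).ennreal_ofReal.aemeasurable] at hsum
  have hae := ae_lt_top (Measurable.tsum fun n => (hYm n).ennreal_ofReal) hsum
  filter_upwards [hae] with ω hω
  have hY0 : Tendsto (fun n => Y n ω) atTop (𝓝 0) := by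
    have := ENNReal.tendsto_atTop_zero_of_tsum_ne_top hω.ne
    have h2 := (ENNReal.tendsto_toReal ENNReal.zero_ne_top).comp this
    refine h2.congr fun n => ?_
    exact ENNReal.toReal_ofReal (sq_nonneg _)
  have hM0 : Tendsto (fun n : ℕ => M (n ^ 2) ω / (n ^ 2 : ℕ)) atTop (𝓝 0) := by
    rw [tendsto_zero_iff_abs_tendsto_zero]
    have := (Real.continuous_sqrt.tendsto 0).comp hY0
    rw [Real.sqrt_zero] at this
    exact this.congr fun n => Real.sqrt_sq_eq_abs _
  -- Adding `C n` makes the sums monotone, which controls them between consecutive squares.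
  have hmono : Monotone fun n : ℕ => M n ω + C * n := monotone_nat_of_le_succ fun n => by
    simp only [hM, Finset.sum_range_succ]
    push_cast
    linarith [(abs_le.1 (hC (Z n ω) (Z (n + 1) ω))).1]
  have hdiv : ∀ {n : ℕ}, n ≠ 0 → (M n ω + C * n) / n = M n ω / n + C := fun {n} hn => by
    have : (n : ℝ) ≠ 0 := Nat.cast_ne_zero.2 hn
    field_simp
  have key := tendsto_div_of_monotone_of_exists_subseq_tendsto_div
    (fun n : ℕ => M n ω + C * n) C hmono fun a ha => by
      refine ⟨fun n => n ^ 2, ?_, tendsto_pow_atTop two_ne_zero, ?_⟩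
      · have h1 : Tendsto (fun n : ℕ => (1 + 1 / (n : ℝ)) ^ 2) atTop (𝓝 ((1 + 0) ^ 2)) :=
          (tendsto_const_nhds.add tendsto_one_div_atTop_nhds_zero_nat).pow 2
        have h2 : ∀ᶠ n : ℕ in atTop, (1 + 1 / (n : ℝ)) ^ 2 < a :=
          h1.eventually_lt_const (by simpa using ha)
        filter_upwards [h2, eventually_gt_atTop 0] with n hn hn0
        have hn' : (0 : ℝ) < n := by exact_mod_cast hn0
        push_cast
        calc ((n : ℝ) + 1) ^ 2 = (1 + 1 / (n : ℝ)) ^ 2 * (n : ℝ) ^ 2 := by field_simp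
          _ ≤ a * (n : ℝ) ^ 2 := by gcongr
      · have := hM0.add_const C
        rw [zero_add] at this
        refine this.congr' ?_
        filter_upwards [eventually_gt_atTop 0] with n hn
        exact (hdiv (pow_ne_zero 2 hn.ne')).symm
  have := key.sub_const C
  rw [sub_self] at this
  refine this.congr' ?_
  filter_upwards [eventually_gt_atTop 0] with n hn
  rw [hdiv hn.ne', add_sub_cancel_right]

end StrongLaw

/-! ### Poisson equation and stationary distributions of finite stochastic matrices. -/

section Poisson

variable {S : Type*} [Fintype S]

/-- Maximum principle: a subharmonic function off `A` that is nonpositive on `A` is nonpositive,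
when no nonempty set disjoint from `A` is closed under the transitions of `Q`. -/
lemma le_zero_of_subharmonic {Q : Matrix S S ℝ} (hQ : ∀ x y, 0 ≤ Q x y)
    (hQ1 : ∀ x, ∑ y, Q x y = 1) {A : Set S}
    (hA : ∀ B : Set S, B.Nonempty → (∀ x ∈ B, x ∉ A) → ∃ x ∈ B, ∃ y ∉ B, 0 < Q x y)
    {f : S → ℝ} (hfA : ∀ x ∈ A, f x ≤ 0) (hf : ∀ x ∉ A, f x ≤ ∑ y, Q x y * f y) (x : S) :
    f x ≤ 0 := by
  by_contra! hx
  have : Nonempty S := ⟨x⟩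
  obtain ⟨m, hm⟩ := Finite.exists_max f
  have hm0 : 0 < f m := hx.trans_le (hm x)
  -- The set where `f` is maximal would miss `A`, so some transition leaves it; averaging there is
  -- strictly below the maximum.
  obtain ⟨a, ha, b, hb, hab⟩ := hA {y | f y = f m} ⟨m, rfl⟩ (fun y hy hyA => by
    have := hfA y hyA
    rw [Set.mem_ofPred_eq] at hy
    linarith)
  have ha' : f a = f m := ha
  have haA : a ∉ A := fun h => by linarith [hfA a h]
  have hlt : f b < f m := lt_of_le_of_ne (hm b) hb
  have : ∑ y, Q a y * f y < ∑ y, Q a y * f m :=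
    Finset.sum_lt_sum (fun y _ => mul_le_mul_of_nonneg_left (hm y) (hQ a y))
      ⟨b, Finset.mem_univ b, mul_lt_mul_of_pos_left hlt hab⟩
  rw [← Finset.sum_mul, hQ1, one_mul] at this
  linarith [hf a haA]

/-- Solvability of the Dirichlet problem for `1 - Q` off `A`. -/
lemma exists_dirichlet {Q : Matrix S S ℝ} (hQ : ∀ x y, 0 ≤ Q x y)
    (hQ1 : ∀ x, ∑ y, Q x y = 1) {A : Set S}
    (hA : ∀ B : Set S, B.Nonempty → (∀ x ∈ B, x ∉ A) → ∃ x ∈ B, ∃ y ∉ B, 0 < Q x y)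
    (g : S → ℝ) :
    ∃ f : S → ℝ, (∀ x ∈ A, f x = 0) ∧ ∀ x ∉ A, f x = g x + ∑ y, Q x y * f y := by
  classical
  -- The identity on `A` and `1 - Q` off `A`: injectivity, hence surjectivity, comes from the
  -- maximum principle applied to `f` and `-f`.
  let T : (S → ℝ) →ₗ[ℝ] (S → ℝ) :=
    { toFun := fun f x => if x ∈ A then f x else f x - ∑ y, Q x y * f y
      map_add' := fun f f' => by
        ext x
        by_cases hx : x ∈ A <;> simp [hx, mul_add, Finset.sum_add_distrib]
        ring
      map_smul' := fun c f => by
        ext x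
        by_cases hx : x ∈ A <;> simp [hx, mul_sub, Finset.mul_sum, mul_left_comm] }
  have hT : ∀ f x, T f x = if x ∈ A then f x else f x - ∑ y, Q x y * f y := fun _ _ => rfl
  have hinj : Function.Injective T := by
    rw [injective_iff_map_eq_zero]
    intro f hf
    have h1 : ∀ x ∈ A, f x = 0 := fun x hx => by
      have := congrFun hf x
      rwa [hT, if_pos hx] at this
    have h2 : ∀ x ∉ A, f x = ∑ y, Q x y * f y := fun x hx => by
      have := congrFun hf x
      rw [hT, if_neg hx] at this
      exact sub_eq_zero.1 this
    ext x
    refine le_antisymm (le_zero_of_subharmonic hQ hQ1 hA (fun x hx => (h1 x hx).le)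
      (fun x hx => (h2 x hx).le) x) ?_
    have := le_zero_of_subharmonic hQ hQ1 hA (f := -f) (fun x hx => by simp [h1 x hx])
      (fun x hx => by simp only [Pi.neg_apply, mul_neg, Finset.sum_neg_distrib]
                      rw [← h2 x hx]) x
    simpa using this
  obtain ⟨f, hf⟩ := LinearMap.surjective_of_injective hinj (fun x => if x ∈ A then 0 else g x)
  refine ⟨f, fun x hx => ?_, fun x hx => ?_⟩
  · have := congrFun hf x
    simpa [hT, hx] using this
  · have := congrFun hf x
    simp only [hT, hx, if_false] at this
    linarith

/-- Solvability of the Poisson equation when the source vanishes on a closed set `A` that is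
accessible from everywhere. -/
lemma exists_poisson_of_eqOn_zero {Q : Matrix S S ℝ} (hQ : ∀ x y, 0 ≤ Q x y)
    (hQ1 : ∀ x, ∑ y, Q x y = 1) {A : Set S}
    (hA : ∀ B : Set S, B.Nonempty → (∀ x ∈ B, x ∉ A) → ∃ x ∈ B, ∃ y ∉ B, 0 < Q x y)
    (hclosed : ∀ x ∈ A, ∀ y ∉ A, Q x y = 0) {g : S → ℝ} (hg : ∀ x ∈ A, g x = 0) :
    ∃ f : S → ℝ, ∀ x, f x = g x + ∑ y, Q x y * f y := by
  obtain ⟨f, hf0, hf⟩ := exists_dirichlet hQ hQ1 hA g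
  refine ⟨f, fun x => ?_⟩
  by_cases hx : x ∈ A
  · rw [hf0 x hx, hg x hx, Finset.sum_eq_zero, add_zero]
    intro y _
    by_cases hy : y ∈ A
    · rw [hf0 y hy, mul_zero]
    · rw [hclosed x hx y hy, zero_mul]
  · exact hf x hx

/-- Solvability of the Poisson equation, up to a constant, when `x₀` is accessible from
everywhere. -/
lemma exists_poisson {Q : Matrix S S ℝ} (hQ : ∀ x y, 0 ≤ Q x y)
    (hQ1 : ∀ x, ∑ y, Q x y = 1) (x₀ : S)
    (hA : ∀ B : Set S, B.Nonempty → x₀ ∉ B → ∃ x ∈ B, ∃ y ∉ B, 0 < Q x y) (g : S → ℝ) :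
    ∃ (c : ℝ) (f : S → ℝ), ∀ x, f x = g x - c + ∑ y, Q x y * f y := by
  have hA' : ∀ B : Set S, B.Nonempty → (∀ x ∈ B, x ∉ ({x₀} : Set S)) →
      ∃ x ∈ B, ∃ y ∉ B, 0 < Q x y :=
    fun B hB h => hA B hB fun h0 => h x₀ h0 rfl
  obtain ⟨f, hf0, hf⟩ := exists_dirichlet hQ hQ1 hA' g
  obtain ⟨h, hh0, hh⟩ := exists_dirichlet hQ hQ1 hA' 1
  have h0 : h x₀ = 0 := hh0 x₀ rfl
  have hf0' : f x₀ = 0 := hf0 x₀ rfl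
  have hpos : ∀ x, 0 ≤ h x := fun x => by
    have := le_zero_of_subharmonic hQ hQ1 hA' (f := -h) (fun x hx => by simp [hh0 x hx])
      (fun x hx => by
        simp only [Pi.neg_apply, mul_neg, Finset.sum_neg_distrib]
        have := hh x hx
        simp only [Pi.one_apply] at this
        linarith) x
    simpa using this
  have hs : 0 ≤ ∑ y, Q x₀ y * h y := Finset.sum_nonneg fun y _ => mul_nonneg (hQ _ _) (hpos y)
  set s := ∑ y, Q x₀ y * h y with hs_def
  -- Renewal formula: `h` is the mean hitting time of `x₀`, so the constant is the mean of `g`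
  -- accumulated over an excursion from `x₀`, divided by the mean return time.
  refine ⟨(g x₀ + ∑ y, Q x₀ y * f y) / (1 + s),
    fun x => f x - (g x₀ + ∑ y, Q x₀ y * f y) / (1 + s) * h x, fun x => ?_⟩
  set c := (g x₀ + ∑ y, Q x₀ y * f y) / (1 + s) with hc
  have hc' : c * (1 + s) = g x₀ + ∑ y, Q x₀ y * f y := by
    rw [hc]; field_simp
  have hsum : ∑ y, Q x y * (f y - c * h y) = ∑ y, Q x y * f y - c * ∑ y, Q x y * h y := by
    rw [Finset.mul_sum, ← Finset.sum_sub_distrib]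
    exact Finset.sum_congr rfl fun y _ => by ring
  rw [hsum]
  change f x - c * h x = _
  by_cases hx : x = x₀
  · subst hx
    rw [h0, hf0', ← hs_def]
    linarith
  · rw [hf x hx, hh x hx]
    simp only [Pi.one_apply]
    ring

/-- The constant in the Poisson equation is at least any lower bound of the source. -/
lemma le_poisson_const [Nonempty S] {Q : Matrix S S ℝ} (hQ : ∀ x y, 0 ≤ Q x y)
    (hQ1 : ∀ x, ∑ y, Q x y = 1) {g f : S → ℝ} {c a : ℝ} (ha : ∀ x, a ≤ g x)
    (h : ∀ x, f x = g x - c + ∑ y, Q x y * f y) : a ≤ c := by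
  obtain ⟨m, hm⟩ := Finite.exists_min f
  have : ∑ y, Q m y * f m ≤ ∑ y, Q m y * f y :=
    Finset.sum_le_sum fun y _ => mul_le_mul_of_nonneg_left (hm y) (hQ m y)
  rw [← Finset.sum_mul, hQ1, one_mul] at this
  linarith [h m, ha m]

/-- The constant in the Poisson equation is determined by the source. -/
lemma poisson_const_unique [Nonempty S] {Q : Matrix S S ℝ} (hQ : ∀ x y, 0 ≤ Q x y)
    (hQ1 : ∀ x, ∑ y, Q x y = 1) {g f f' : S → ℝ} {c c' : ℝ}
    (h : ∀ x, f x = g x - c + ∑ y, Q x y * f y)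
    (h' : ∀ x, f' x = g x - c' + ∑ y, Q x y * f' y) : c = c' := by
  have key : ∀ {u v : S → ℝ} {a b : ℝ}, (∀ x, u x = g x - a + ∑ y, Q x y * u y) →
      (∀ x, v x = g x - b + ∑ y, Q x y * v y) → a ≤ b := by
    intro u v a b hu hv
    -- The difference of the two solutions solves the equation with source zero and constant `b -
    -- a`.
    have : 0 ≤ b - a := le_poisson_const hQ hQ1 (g := 0) (f := fun x => v x - u x)
      (fun _ => le_rfl) (fun x => by
        simp only [mul_sub, Finset.sum_sub_distrib, Pi.zero_apply]
        linarith [hu x, hv x])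
    linarith
  exact le_antisymm (key h h') (key h' h)

/-- For a stationary distribution, the constant in the Poisson equation is the mean of the
source. -/
lemma IsStationary.poisson_const {Q : Matrix S S ℝ} {π : S → ℝ} (hπ : IsStationary Q π)
    {g f : S → ℝ} {c : ℝ} (h : ∀ x, f x = g x - c + ∑ y, Q x y * f y) :
    c = ∑ x, π x * g x := by
  have h1 : ∑ x, π x * f x = ∑ x, π x * g x - c + ∑ x, π x * ∑ y, Q x y * f y := by
    rw [← one_mul c, ← hπ.sum_eq_one, Finset.sum_mul, ← Finset.sum_sub_distrib,
      ← Finset.sum_add_distrib]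
    refine Finset.sum_congr rfl fun x _ => ?_
    conv_lhs => rw [h x]
    ring
  have h2 : ∑ x, π x * ∑ y, Q x y * f y = ∑ y, π y * f y := by
    simp_rw [Finset.mul_sum]
    rw [Finset.sum_comm]
    refine Finset.sum_congr rfl fun y _ => ?_
    conv_rhs => rw [← hπ.stationary]
    simp only [Matrix.vecMul, dotProduct, Finset.sum_mul, mul_assoc]
  linarith

/-- Existence and uniqueness of the stationary distribution when `x₀` is accessible from
everywhere. -/
lemma exists_unique_stationary {Q : Matrix S S ℝ} (hQ : ∀ x y, 0 ≤ Q x y)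
    (hQ1 : ∀ x, ∑ y, Q x y = 1) (x₀ : S)
    (hA : ∀ B : Set S, B.Nonempty → x₀ ∉ B → ∃ x ∈ B, ∃ y ∉ B, 0 < Q x y) :
    ∃ π : S → ℝ, IsStationary Q π ∧ ∀ π' : S → ℝ, IsStationary Q π' → π' = π := by
  classical
  have : Nonempty S := ⟨x₀⟩
  -- The constant depends linearly, monotonically and invariantly on the source; its values on point
  -- masses form the stationary law.
  choose π f hf using fun y : S => exists_poisson hQ hQ1 x₀ hA (Pi.single y 1)
  have hlin : ∀ (g : S → ℝ) x, ∑ z, g z * f z x =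
      g x - ∑ z, π z * g z + ∑ y, Q x y * ∑ z, g z * f z y := by
    intro g x
    have h1 : ∑ y, Q x y * ∑ z, g z * f z y = ∑ z, g z * ∑ y, Q x y * f z y := by
      simp_rw [Finset.mul_sum]
      rw [Finset.sum_comm]
      exact Finset.sum_congr rfl fun _ _ => Finset.sum_congr rfl fun _ _ => by ring
    have h2 : g x = ∑ z, g z * (Pi.single z 1 : S → ℝ) x := by
      simp [Pi.single_apply]
    rw [h1, h2, ← Finset.sum_sub_distrib, ← Finset.sum_add_distrib]
    refine Finset.sum_congr rfl fun z _ => ?_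
    conv_lhs => rw [hf z x]
    ring
  refine ⟨π, ⟨fun x => ?_, ?_, ?_⟩, fun π' hπ' => ?_⟩
  · refine le_poisson_const hQ hQ1 (fun y => ?_) (hf x)
    by_cases hxy : y = x
    · subst hxy; simp
    · simp [hxy]
  · have := poisson_const_unique hQ hQ1 (hlin 1) (f' := 0) (c' := 1) (fun x => by simp)
    simpa using this
  · ext y
    have := poisson_const_unique hQ hQ1 (hlin fun x => Q x y)
      (f' := fun x => f y x - (Pi.single y 1 : S → ℝ) x) (c' := π y) (fun x => by
        conv_lhs => rw [hf y x]
        simp [mul_sub, Finset.sum_sub_distrib, Pi.single_apply]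
        ring)
    exact this
  · ext y
    have := hπ'.poisson_const (hf y)
    rw [this]
    simp [Pi.single_apply]

end Poisson

/-! ### Existence of a chain with given transition matrix. -/

section Construction

/-- The chain driven by a field of independent transitions, started at `s₀`. -/
def drivenChain {S : Type*} (s₀ : S) : ℕ → (ℕ × S → S) → S
  | 0, _ => s₀
  | n + 1, ω => ω (n, drivenChain s₀ n ω)

lemma drivenChain_eq_iff {S : Type*} (s₀ : S) (ω : ℕ × S → S) (n : ℕ) (z : ℕ → S)
    (h0 : z 0 = s₀) :
    (∀ k ≤ n, drivenChain s₀ k ω = z k) ↔ ∀ k < n, ω (k, z k) = z (k + 1) := by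
  induction n with
  | zero => simp [drivenChain, h0]
  | succ n ih =>
    constructor
    · intro h k hk
      have h1 := h (k + 1) (by lia)
      rwa [drivenChain, h k (by lia)] at h1
    · intro h k hk
      have h1 := ih.2 fun j hj => h j (by lia)
      rcases Nat.lt_or_ge k (n + 1) with hk' | hk'
      · exact h1 k (by lia)
      · obtain rfl : k = n + 1 := by lia
        rw [drivenChain, h1 n le_rfl]
        exact h n (by lia)

/-- Every stochastic matrix on a finite type is the transition matrix of a Markov chain. -/
lemma exists_isMarkovChain {S : Type} [Fintype S] [Nonempty S] {Q : Matrix S S ℝ}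
    (hQ : ∀ x y, 0 ≤ Q x y) (hQ1 : ∀ x, ∑ y, Q x y = 1) :
    ∃ (Ω : Type) (_ : MeasurableSpace Ω) (ℙ : Measure Ω) (_ : IsProbabilityMeasure ℙ)
      (Z : ℕ → Ω → S), IsMarkovChain ℙ Q Z := by
  classical
  let _ : MeasurableSpace S := ⊤
  have : DiscreteMeasurableSpace S := ⟨fun _ => trivial⟩
  have hsum : ∀ s, ∑ y, ENNReal.ofReal (Q s y) = 1 := fun s => by
    rw [← ENNReal.ofReal_sum_of_nonneg fun y _ => hQ s y, hQ1, ENNReal.ofReal_one]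
  let ν : ℕ × S → Measure S := fun a => (PMF.ofFintype _ (hsum a.2)).toMeasure
  have hν : ∀ a y, ν a {y} = ENNReal.ofReal (Q a.2 y) := fun a y => by
    simp only [ν]
    rw [PMF.toMeasure_apply_singleton _ _ (measurableSet_singleton y), PMF.ofFintype_apply]
  obtain ⟨s₀⟩ : Nonempty S := inferInstance
  have hmeas : ∀ n s, MeasurableSet {ω : ℕ × S → S | drivenChain s₀ n ω = s} := by
    intro n
    induction n with
    | zero =>
      intro s
      simp only [drivenChain]
      exact MeasurableSet.const _
    | succ n ih =>
      intro s
      have : {ω : ℕ × S → S | drivenChain s₀ (n + 1) ω = s} =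
          ⋃ t, {ω | drivenChain s₀ n ω = t} ∩ (fun ω : ℕ × S → S => ω (n, t)) ⁻¹' {s} := by
        ext ω
        simp [drivenChain]
      rw [this]
      exact MeasurableSet.iUnion fun t => (ih t).inter
        (measurable_pi_apply (n, t) (measurableSet_singleton s))
  refine ⟨ℕ × S → S, inferInstance, Measure.infinitePi ν, inferInstance, drivenChain s₀,
    hmeas, fun n z => ?_⟩
  by_cases h0 : z 0 = s₀
  -- A path prescribes the coordinates `(k, z k)`, `k < n`. The time index keeps them distinct even
  -- if states recur, so the product measure factorises.
  · have hset : {ω : ℕ × S → S | ∀ k ≤ n, drivenChain s₀ k ω = z k} =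
        Set.pi ((Finset.range n).image fun k => (k, z k) : Finset (ℕ × S))
          fun a => {z (a.1 + 1)} := by
      ext ω
      rw [Set.mem_ofPred_eq, drivenChain_eq_iff s₀ ω n z h0]
      simp
    have hinj : Set.InjOn (fun k => (k, z k)) (Finset.range n : Set ℕ) :=
      fun a _ b _ hab => (Prod.ext_iff.1 hab).1
    rw [measureReal_def, hset, Measure.infinitePi_pi _ fun _ _ => measurableSet_singleton _,
      Finset.prod_image hinj]
    have h1 : {ω : ℕ × S → S | drivenChain s₀ 0 ω = z 0} = Set.univ := by
      ext ω
      simp [drivenChain, h0]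
    rw [h1, probReal_univ, one_mul, ENNReal.toReal_prod]
    refine Finset.prod_congr rfl fun k _ => ?_
    rw [hν, ENNReal.toReal_ofReal (hQ _ _)]
  · have h1 : {ω : ℕ × S → S | drivenChain s₀ 0 ω = z 0} = ∅ := by
      ext ω
      simpa [drivenChain] using fun h => h0 h.symm
    have h2 : {ω : ℕ × S → S | ∀ k ≤ n, drivenChain s₀ k ω = z k} = ∅ := by
      ext ω
      simp only [Set.mem_ofPred_eq, Set.mem_empty_iff_false, iff_false]
      exact fun h => h0 (h 0 (Nat.zero_le n)).symm
    rw [h1, h2, measureReal_empty, zero_mul]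

end Construction

/-! ### From the Poisson equation to the mean profit. -/

section MeanProfit

variable {N : ℕ} {p : Fin 4 → ℝ}

lemma changeProb_add_stayProb (p : Fin 4 → ℝ) (x : State N) (i : ZMod N) :
    changeProb p x i + stayProb p x i = 1 := by
  unfold changeProb stayProb
  split_ifs <;> ring

lemma changeProb_nonneg (hp : ∀ m, p m ∈ Set.Icc (0 : ℝ) 1) (x : State N) (i : ZMod N) :
    0 ≤ changeProb p x i := by
  unfold changeProb
  split_ifs
  · exact (hp _).1
  · exact sub_nonneg.2 (hp _).2

lemma stayProb_nonneg (hp : ∀ m, p m ∈ Set.Icc (0 : ℝ) 1) (x : State N) (i : ZMod N) :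
    0 ≤ stayProb p x i := by
  unfold stayProb
  split_ifs
  · exact sub_nonneg.2 (hp _).2
  · exact (hp _).1

variable [NeZero N]

/-- The action of the transition matrix on functions. -/
lemma sum_P_mul (x : State N) (f : State N → ℝ) :
    ∑ y, P N p x y * f y =
      (N : ℝ)⁻¹ * ∑ i, (changeProb p x i * f (flip x i) + stayProb p x i * f x) := by
  simp only [P, mul_assoc, Finset.sum_mul]
  rw [← Finset.mul_sum, Finset.sum_comm]
  simp [add_mul, Finset.sum_add_distrib]

lemma sum_PStar_mul (z : StarState N) (F : StarState N → ℝ) :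
    ∑ w, PStar N p z w * F w = (N : ℝ)⁻¹ * ∑ j, (changeProb p z.1 z.2 * F (flip z.1 z.2, j) +
      stayProb p z.1 z.2 * F (z.1, j)) := by
  simp only [PStar, mul_assoc]
  rw [← Finset.mul_sum, Fintype.sum_prod_type, Finset.sum_comm]
  simp [add_mul, Finset.sum_add_distrib]

lemma inv_mul_sum_const (c : ℝ) : (N : ℝ)⁻¹ * ∑ _i : ZMod N, c = c := by
  have : (N : ℝ) ≠ 0 := Nat.cast_ne_zero.2 (NeZero.ne N)
  simp [ZMod.card, this]

lemma P_nonneg (hp : ∀ m, p m ∈ Set.Icc (0 : ℝ) 1) (x y : State N) : 0 ≤ P N p x y := by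
  refine mul_nonneg (by positivity) (Finset.sum_nonneg fun i _ => add_nonneg ?_ ?_)
  · split_ifs
    exacts [changeProb_nonneg hp x i, le_rfl]
  · split_ifs
    exacts [stayProb_nonneg hp x i, le_rfl]

lemma sum_P (x : State N) : ∑ y, P N p x y = 1 := by
  have := sum_P_mul (p := p) x 1
  simp only [Pi.one_apply, mul_one, changeProb_add_stayProb] at this
  rw [this, inv_mul_sum_const]

lemma PStar_nonneg (hp : ∀ m, p m ∈ Set.Icc (0 : ℝ) 1) (z w : StarState N) :
    0 ≤ PStar N p z w := by
  refine mul_nonneg (by positivity) (add_nonneg ?_ ?_)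
  · split_ifs
    exacts [changeProb_nonneg hp _ _, le_rfl]
  · split_ifs
    exacts [stayProb_nonneg hp _ _, le_rfl]

lemma sum_PStar (z : StarState N) : ∑ w, PStar N p z w = 1 := by
  have := sum_PStar_mul (p := p) z 1
  simp only [Pi.one_apply, mul_one, changeProb_add_stayProb] at this
  rw [this, inv_mul_sum_const]

/-- Expected profit of a turn in state `x`. -/
noncomputable def meanPayoff (p : Fin 4 → ℝ) (x : State N) : ℝ :=
  (N : ℝ)⁻¹ * ∑ i, (2 * p (nbr x i) - 1)

lemma fin_two_cases (a : Fin 2) : a = 0 ∨ a = 1 := by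
  fin_cases a <;> simp

/-- A solution of the Poisson equation for the mean payoff identifies the mean profit. -/
lemma isMeanProfit_of_poisson {μ : ℝ} {f : State N → ℝ}
    (hf : ∀ x, f x = meanPayoff p x - μ + ∑ y, P N p x y * f y) : IsMeanProfit N p μ := by
  intro Ω _ ℙ _ Z hZ
  -- Lift of `f` to the chain that knows the next player: the expectation of payoff `- μ +` new
  -- value of `f`, given that player. Averaging over the player returns `f`.
  let F : StarState N → ℝ := fun z => (2 * p (nbr z.1 z.2) - 1) - μ +
    (changeProb p z.1 z.2 * f (flip z.1 z.2) + stayProb p z.1 z.2 * f z.1)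
  have hF : ∀ x, (N : ℝ)⁻¹ * ∑ j, F (x, j) = f x := fun x => by
    rw [hf x, sum_P_mul, meanPayoff]
    simp only [F]
    rw [Finset.sum_add_distrib, Finset.sum_sub_distrib, mul_add, mul_sub, inv_mul_sum_const]
  have hφ : ∀ z, ∑ w, PStar N p z w * (payoff z w - μ + F w - F z) = 0 := fun z => by
    rw [sum_PStar_mul]
    have h1 : ∀ j : ZMod N, payoff z (flip z.1 z.2, j) = if z.1 z.2 = 0 then 1 else -1 := by
      intro j
      rcases fin_two_cases (z.1 z.2) with h | h <;> simp [payoff, flip, h]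
    have h2 : ∀ j : ZMod N, payoff z (z.1, j) = if z.1 z.2 = 0 then -1 else 1 := by
      intro j
      rcases fin_two_cases (z.1 z.2) with h | h <;> simp [payoff, h]
    have h3 : ∀ j : ZMod N,
        changeProb p z.1 z.2 * (payoff z (flip z.1 z.2, j) - μ + F (flip z.1 z.2, j) - F z) +
          stayProb p z.1 z.2 * (payoff z (z.1, j) - μ + F (z.1, j) - F z) =
        ((2 * p (nbr z.1 z.2) - 1) - μ - F z) + (changeProb p z.1 z.2 * F (flip z.1 z.2, j) +
          stayProb p z.1 z.2 * F (z.1, j)) := by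
      intro j
      rw [h1, h2]
      unfold changeProb stayProb
      split_ifs <;> ring
    simp_rw [h3]
    rw [Finset.sum_add_distrib, Finset.sum_add_distrib, ← Finset.mul_sum, ← Finset.mul_sum,
      mul_add, inv_mul_sum_const, mul_add, mul_left_comm, hF, mul_left_comm, hF]
    simp only [F]
    ring
  obtain ⟨C, hC⟩ : ∃ C, ∀ z, |F z| ≤ C :=
    ⟨∑ z, |F z|, fun z => Finset.single_le_sum (f := fun z => |F z|)
      (fun _ _ => abs_nonneg _) (Finset.mem_univ z)⟩
  filter_upwards [hZ.ae_tendsto_div hφ] with ω hω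
  have hsum : ∀ n : ℕ, ∑ k ∈ Finset.range n,
      (payoff (Z k ω) (Z (k + 1) ω) - μ + F (Z (k + 1) ω) - F (Z k ω)) =
      totalProfit Z n ω - n * μ + (F (Z n ω) - F (Z 0 ω)) := by
    intro n
    rw [totalProfit, ← Finset.sum_range_sub (fun k => F (Z k ω))]
    simp only [add_sub_assoc, Finset.sum_add_distrib, Finset.sum_sub_distrib, Finset.sum_const,
      Finset.card_range, nsmul_eq_mul]
  have hbd : Tendsto (fun n : ℕ => (F (Z n ω) - F (Z 0 ω)) / (n : ℝ)) atTop (𝓝 0) := by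
    refine squeeze_zero_norm (a := fun n : ℕ => 2 * C / (n : ℝ)) (fun n => ?_)
      (tendsto_const_div_atTop_nhds_zero_nat _)
    rw [norm_div, Real.norm_eq_abs, Real.norm_natCast]
    gcongr
    refine (abs_sub _ _).trans ?_
    linarith [hC (Z n ω), hC (Z 0 ω)]
  have := (hω.sub hbd).add_const μ
  rw [sub_zero, zero_add] at this
  refine this.congr' ?_
  filter_upwards [eventually_gt_atTop 0] with n hn
  have hn' : (n : ℝ) ≠ 0 := Nat.cast_ne_zero.2 hn.ne'
  rw [hsum]
  field_simp
  ring

/-- The mean profit is unique, since the chain exists. -/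
lemma isMeanProfit_unique (hp : ∀ m, p m ∈ Set.Icc (0 : ℝ) 1) {μ μ' : ℝ}
    (h : IsMeanProfit N p μ) (h' : IsMeanProfit N p μ') : μ = μ' := by
  obtain ⟨Ω, _, ℙ, _, Z, hZ⟩ := exists_isMarkovChain (PStar_nonneg (N := N) hp) sum_PStar
  obtain ⟨ω, hω, hω'⟩ := ((h Ω ℙ Z hZ).and (h' Ω ℙ Z hZ)).exists
  exact tendsto_nhds_unique hω hω'

lemma isMeanProfit_iff_of_poisson (hp : ∀ m, p m ∈ Set.Icc (0 : ℝ) 1) {μ : ℝ}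
    {f : State N → ℝ} (hf : ∀ x, f x = meanPayoff p x - μ + ∑ y, P N p x y * f y) (μ' : ℝ) :
    IsMeanProfit N p μ' ↔ μ' = μ :=
  ⟨fun h => isMeanProfit_unique hp h (isMeanProfit_of_poisson hf),
    fun h => h ▸ isMeanProfit_of_poisson hf⟩

end MeanProfit

/-! ### Changes of a single status and the number of winners. -/

section Flips

variable {N : ℕ}

lemma flip_apply_self (x : State N) (i : ZMod N) : flip x i i = 1 - x i := by
  simp [flip]

lemma flip_apply_of_ne (x : State N) {i j : ZMod N} (h : j ≠ i) : flip x i j = x j := by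
  simp [flip, h]

lemma flip_flip (x : State N) (i : ZMod N) : flip (flip x i) i = x := by
  simp [flip]

variable [NeZero N] {p : Fin 4 → ℝ}

lemma P_flip_pos (hp : ∀ m, p m ∈ Set.Icc (0 : ℝ) 1) {x : State N} {i : ZMod N}
    (h : 0 < changeProb p x i) : 0 < P N p x (flip x i) := by
  have hN : (0 : ℝ) < N := Nat.cast_pos.2 (NeZero.pos N)
  have hnn : ∀ j : ZMod N, 0 ≤ (if flip x i = flip x j then changeProb p x j else 0) +
      (if flip x i = x then stayProb p x j else 0) := fun j => by
    refine add_nonneg ?_ ?_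
    · split_ifs
      exacts [changeProb_nonneg hp x j, le_rfl]
    · split_ifs
      exacts [stayProb_nonneg hp x j, le_rfl]
  refine mul_pos (inv_pos.2 hN) (Finset.sum_pos' (fun j _ => hnn j) ⟨i, Finset.mem_univ i, ?_⟩)
  rw [if_pos rfl]
  refine add_pos_of_pos_of_nonneg h ?_
  split_ifs
  exacts [stayProb_nonneg hp x i, le_rfl]

/-- Number of winners. -/
noncomputable def ones (x : State N) : ℝ := ∑ i, ((x i).val : ℝ)

lemma ones_flip (x : State N) (i : ZMod N) :
    ones (flip x i) = ones x + (1 - 2 * ((x i).val : ℝ)) := by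
  rw [← sub_eq_iff_eq_add', ones, ones, ← Finset.sum_sub_distrib,
    Finset.sum_eq_single i (fun j _ hj => by rw [flip_apply_of_ne x hj, sub_self]) (by simp),
    flip_apply_self]
  rcases fin_two_cases (x i) with h | h <;> simp [h]
  norm_num

/-- Drift of the number of winners. -/
lemma sum_P_mul_ones (x : State N) :
    ∑ y, P N p x y * ones y =
      ones x + (N : ℝ)⁻¹ * ∑ i, (p (nbr x i) - ((x i).val : ℝ)) := by
  have h : ∀ i, changeProb p x i * ones (flip x i) + stayProb p x i * ones x =
      ones x + (p (nbr x i) - ((x i).val : ℝ)) := fun i => by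
    rw [ones_flip]
    rcases fin_two_cases (x i) with h | h <;> simp [changeProb, stayProb, h] <;> ring
  rw [sum_P_mul]
  simp_rw [h]
  rw [Finset.sum_add_distrib, mul_add, inv_mul_sum_const]

lemma sum_add_one (c : ZMod N → ℝ) : ∑ i, c (i + 1) = ∑ i, c i :=
  Equiv.sum_comp (Equiv.addRight (1 : ZMod N)) c

lemma sum_sub_one (c : ZMod N → ℝ) : ∑ i, c (i - 1) = ∑ i, c i :=
  Equiv.sum_comp (Equiv.subRight (1 : ZMod N)) c

end Flips

/-! ### Game `B`: dynamics of defects. -/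

section GameB

variable {N : ℕ}

lemma one_sub_eq_iff (a b : Fin 2) : 1 - a = b ↔ ¬ a = b := by
  revert a b; decide

lemma eq_one_sub_iff (a b : Fin 2) : a = 1 - b ↔ ¬ a = b := by
  revert a b; decide

lemma zmod_add_one_ne (hN : 2 ≤ N) (i : ZMod N) : i + 1 ≠ i := by
  have : Fact (1 < N) := ⟨hN⟩
  simp

variable [NeZero N]

/-- The edges `(i, i + 1)` of the circle joining two players of equal status. -/
def defects (x : State N) : Finset (ZMod N) := Finset.univ.filter fun i => x i = x (i + 1)

lemma mem_defects {x : State N} {i : ZMod N} : i ∈ defects x ↔ x i = x (i + 1) := by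
  simp [defects]

lemma sub_one_mem_defects {x : State N} {i : ZMod N} :
    i - 1 ∈ defects x ↔ x (i - 1) = x i := by
  simp [defects]

/-- Player `i` lies on the edges `i - 1` and `i` only, and changing his status toggles exactly
these. -/
lemma mem_defects_flip (hN : 2 ≤ N) (x : State N) (i j : ZMod N) :
    j ∈ defects (flip x i) ↔ (if j = i ∨ j = i - 1 then j ∉ defects x else j ∈ defects x) := by
  have hi := zmod_add_one_ne hN
  by_cases h1 : j = i
  · subst h1
    simp only [mem_defects, true_or, if_true]
    rw [flip_apply_self, flip_apply_of_ne x (hi j), one_sub_eq_iff]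
  by_cases h2 : j = i - 1
  · subst h2
    simp only [mem_defects, or_true, if_true, sub_add_cancel]
    rw [flip_apply_self, flip_apply_of_ne x h1, eq_one_sub_iff]
  · simp only [h1, h2, or_self, if_false, mem_defects]
    rw [flip_apply_of_ne x h1, flip_apply_of_ne x fun h => h2 (eq_sub_of_add_eq h)]

lemma card_defects_flip_lt (hN : 2 ≤ N) {x : State N} {i : ZMod N} (h : i ∈ defects x)
    (h' : i - 1 ∈ defects x) : (defects (flip x i)).card < (defects x).card := by
  refine Finset.card_lt_card ((Finset.ssubset_iff_of_subset fun j hj => ?_).2 ⟨i, h, ?_⟩)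
  · rw [mem_defects_flip hN] at hj
    by_cases h1 : j = i
    · rwa [h1]
    by_cases h2 : j = i - 1
    · rwa [h2]
    simpa [h1, h2] using hj
  · simp [mem_defects_flip hN, h]

/-- With a single defect next to player `i`, his change of status carries it over to his other edge.
-/
lemma card_defects_flip_eq (hN : 2 ≤ N) {x : State N} {i : ZMod N}
    (h : ¬ (i ∈ defects x ↔ i - 1 ∈ defects x)) :
    (defects (flip x i)).card = (defects x).card := by
  have hne : i - 1 ≠ i := fun h => zmod_add_one_ne hN (i - 1) (by rw [sub_add_cancel]; exact h.symm)
  by_cases h1 : i ∈ defects x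
  · have h2 : i - 1 ∉ defects x := fun h2 => h (by simp [h1, h2])
    have : defects (flip x i) = insert (i - 1) ((defects x).erase i) := by
      ext j
      rw [mem_defects_flip hN]
      by_cases hj : j = i
      · subst hj; simp [h1, hne.symm]
      by_cases hj' : j = i - 1
      · subst hj'; simp [h2]
      simp [hj, hj']
    rw [this, Finset.card_insert_of_notMem (by simp [h2]), Finset.card_erase_add_one h1]
  · have h2 : i - 1 ∈ defects x := by
      by_contra h2
      exact h (by simp [h1, h2])
    have : defects (flip x i) = insert i ((defects x).erase (i - 1)) := by
      ext j
      rw [mem_defects_flip hN]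
      by_cases hj : j = i
      · subst hj; simp [h1]
      by_cases hj' : j = i - 1
      · subst hj'; simp [h2, hne]
      simp [hj, hj']
    rw [this, Finset.card_insert_of_notMem (by simp [h1]), Finset.card_erase_add_one h2]

lemma changeProb_pos_of_defect {q : ℝ} (hq : q ∈ Set.Ioo (0 : ℝ) 1) {x : State N} {i : ZMod N}
    (h : i ∈ defects x ∨ i - 1 ∈ defects x) : 0 < changeProb ![1, q, q, 0] x i := by
  rw [mem_defects, sub_one_mem_defects] at h
  have h0 := hq.1
  have h1 := hq.2
  rcases fin_two_cases (x (i - 1)) with ha | ha <;> rcases fin_two_cases (x i) with hb | hb <;>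
    rcases fin_two_cases (x (i + 1)) with hc | hc <;>
    simp_all [changeProb, nbr]

/-- This is where `p₀ = 1` and `p₃ = 0` enter: a winner between two losers stays a winner, a loser
between two winners stays a loser. -/
lemma changeProb_eq_zero_of_no_defect {q : ℝ} {x : State N} {i : ZMod N}
    (h : i ∉ defects x) (h' : i - 1 ∉ defects x) : changeProb ![1, q, q, 0] x i = 0 := by
  rw [mem_defects] at h
  rw [sub_one_mem_defects] at h'
  rcases fin_two_cases (x (i - 1)) with ha | ha <;> rcases fin_two_cases (x i) with hb | hb <;>
    rcases fin_two_cases (x (i + 1)) with hc | hc <;>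
    simp_all [changeProb, nbr]

/-- The number of defects has the parity of `N`. -/
lemma card_defects_mod_two (x : State N) : (defects x).card % 2 = N % 2 := by
  -- Modulo 2, the indicator of `a = b` is `a + b + 1`, and around the circle each status is counted
  -- twice.
  have h1 : ((defects x).card : ZMod 2) =
      ∑ i, (((x i).val : ZMod 2) + ((x (i + 1)).val : ZMod 2) + 1) := by
    rw [defects, Finset.card_filter]
    push_cast
    refine Finset.sum_congr rfl fun i _ => ?_
    generalize x i = a
    generalize x (i + 1) = b
    revert a b
    decide
  have h2 : ∑ i, ((x (i + 1)).val : ZMod 2) = ∑ i, ((x i).val : ZMod 2) :=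
    Equiv.sum_comp (Equiv.addRight (1 : ZMod N)) fun i => ((x i).val : ZMod 2)
  rw [Finset.sum_add_distrib, Finset.sum_add_distrib, h2, CharTwo.add_self_eq_zero, zero_add] at h1
  simp only [Finset.sum_const, Finset.card_univ, ZMod.card, nsmul_eq_mul, mul_one] at h1
  exact (ZMod.natCast_eq_natCast_iff _ _ _).1 h1

/-- Away from defects the summand is `2 x_i - 1`, which cancels along alternating neighbours. Each
defect then leaves boundary terms in which the statuses of its ends cancel, so only `2q - 1`
remains. Two adjacent defects would break the termwise formula. -/
lemma sum_of_card_defects_le_one (hN : 2 ≤ N) {q : ℝ} {x : State N}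
    (hx : (defects x).card ≤ 1) :
    ∑ i, ((![1, q, q, 0] : Fin 4 → ℝ) (nbr x i) - 1 + ((x i).val : ℝ)) =
      (defects x).card * (2 * q - 1) := by
  let v : ZMod N → ℝ := fun i => ((x i).val : ℝ)
  let e : ZMod N → ℝ := fun i => if x i = x (i + 1) then 1 else 0
  have he : ((defects x).card : ℝ) = ∑ i, e i := by
    rw [defects, Finset.card_filter]
    push_cast
    rfl
  have hsub : ∀ i, e (i - 1) = if x (i - 1) = x i then 1 else 0 := fun i => by simp [e]
  have hterm : ∀ i, (![1, q, q, 0] : Fin 4 → ℝ) (nbr x i) - 1 + ((x i).val : ℝ) =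
      (2 * v i - 1) + (e (i - 1) * (q - v ((i - 1) + 1)) + e i * (q - v i)) := by
    intro i
    have hnot : ¬ (x (i - 1) = x i ∧ x i = x (i + 1)) := fun ⟨ha, hb⟩ => by
      have := Finset.card_le_one.1 hx i (mem_defects.2 hb) (i - 1) (sub_one_mem_defects.2 ha)
      exact zmod_add_one_ne hN (i - 1) (by rw [sub_add_cancel]; exact this)
    rw [hsub, sub_add_cancel]
    simp only [v, e]
    rcases fin_two_cases (x (i - 1)) with ha | ha <;> rcases fin_two_cases (x i) with hb | hb <;>
      rcases fin_two_cases (x (i + 1)) with hc | hc <;>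
      simp_all [nbr] <;> ring
  have hedge : ∀ i, v i + v (i + 1) - 1 = e i * (v i + v (i + 1) - 1) := by
    intro i
    simp only [v, e]
    rcases fin_two_cases (x i) with hb | hb <;>
      rcases fin_two_cases (x (i + 1)) with hc | hc <;> simp [hb, hc]
  have hv : ∑ i, (2 * v i - 1) = ∑ i, e i * (v i + v (i + 1) - 1) := by
    simp_rw [← hedge]
    rw [Finset.sum_sub_distrib, Finset.sum_sub_distrib, Finset.sum_add_distrib, sum_add_one,
      ← Finset.mul_sum, two_mul]
  simp_rw [hterm]
  rw [Finset.sum_add_distrib, Finset.sum_add_distrib,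
    sum_sub_one fun i => e i * (q - v (i + 1)), hv, he, Finset.sum_mul,
    ← Finset.sum_add_distrib, ← Finset.sum_add_distrib]
  exact Finset.sum_congr rfl fun i _ => by ring

/-- Two defects can be brought together and annihilated. -/
lemma exists_card_defects_lt (hN : 2 ≤ N) {B : Set (State N)}
    (hB : ∀ x ∈ B, ∀ i, i ∈ defects x ∨ i - 1 ∈ defects x → flip x i ∈ B) (d : ℕ)
    (hd : 1 ≤ d) (hdN : d < N) {x : State N} (hx : x ∈ B) {i : ZMod N} (hi : i ∈ defects x)
    (hid : i + d ∈ defects x) : ∃ y ∈ B, (defects y).card < (defects x).card := by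
  induction d, hd using Nat.le_induction generalizing x i with
  | base =>
    rw [Nat.cast_one] at hid
    exact ⟨_, hB x hx (i + 1) (Or.inl hid), card_defects_flip_lt hN hid (by simpa using hi)⟩
  | succ d hd ih =>
    by_cases h1 : i + 1 ∈ defects x
    · exact ⟨_, hB x hx (i + 1) (Or.inl h1), card_defects_flip_lt hN h1 (by simpa using hi)⟩
    -- Flipping player `i + 1` moves the defect from edge `i` to edge `i + 1`, one step closer to
    -- the other.
    have hy := hB x hx (i + 1) (Or.inr (by simpa using hi))
    have hcard : (defects (flip x (i + 1))).card = (defects x).card :=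
      card_defects_flip_eq hN (by simp [h1, hi])
    have hcast : ∀ k : ℕ, 1 ≤ k → k < N → (k : ZMod N) ≠ 0 := fun k hk hkN h => by
      rw [ZMod.natCast_eq_zero_iff] at h
      exact absurd (Nat.le_of_dvd hk h) (by lia)
    have := ih (by lia) hy (i := i + 1) (by simp [mem_defects_flip hN, h1]) (by
      have e : i + 1 + (d : ZMod N) = i + ((d + 1 : ℕ) : ZMod N) := by push_cast; ring
      rw [mem_defects_flip hN, if_neg, e]
      · exact hid
      · rintro (h | h)
        · exact hcast d hd (by lia) (by simpa using h)
        · rw [e, add_sub_cancel_right] at h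
          exact hcast (d + 1) (by lia) hdN (by simpa using h))
    rwa [hcard] at this

lemma gameB_mem_Icc {q : ℝ} (hq : q ∈ Set.Ioo (0 : ℝ) 1) (m : Fin 4) :
    (![1, q, q, 0] : Fin 4 → ℝ) m ∈ Set.Icc (0 : ℝ) 1 := by
  have h0 := hq.1.le
  have h1 := hq.2.le
  fin_cases m <;> simp [h0, h1]

/-- Mean profit of game `B`. -/
lemma isMeanProfit_gameB_iff (hN : 2 ≤ N) {q : ℝ} (hq : q ∈ Set.Ioo (0 : ℝ) 1) (μ : ℝ) :
    IsMeanProfit N ![1, q, q, 0] μ ↔ μ = (N % 2 : ℕ) * (2 * q - 1) / N := by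
  have hp := gameB_mem_Icc hq
  set p : Fin 4 → ℝ := ![1, q, q, 0]
  -- The source is the mean payoff minus the drift of `ones`; unlike the mean payoff, it is constant
  -- on the closed set.
  have hex : ∃ f : State N → ℝ, ∀ x, f x =
      ((N : ℝ)⁻¹ * ∑ i, (p (nbr x i) - 1 + ((x i).val : ℝ)) -
        (N % 2 : ℕ) * (2 * q - 1) / N) + ∑ y, P N p x y * f y := by
    refine exists_poisson_of_eqOn_zero (P_nonneg hp) sum_P
      (A := {x | (defects x).card ≤ 1}) ?_ ?_ ?_
    · intro B hne hBA
      by_contra! hcon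
      have hB : ∀ x ∈ B, ∀ i, i ∈ defects x ∨ i - 1 ∈ defects x → flip x i ∈ B := by
        intro x hx i hi
        by_contra hy
        exact absurd (hcon x hx _ hy) (not_le.2 (P_flip_pos hp (changeProb_pos_of_defect hq hi)))
      obtain ⟨x, hx, hmin⟩ :=
        Set.exists_min_image B (fun x => (defects x).card) B.toFinite hne
      obtain ⟨i, hi, j, hj, hij⟩ := Finset.one_lt_card.1 (not_le.1 (hBA x hx))
      have hd : 1 ≤ (j - i).val := Nat.one_le_iff_ne_zero.2 fun h =>
        hij (sub_eq_zero.1 ((ZMod.val_eq_zero _).1 h)).symm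
      obtain ⟨y, hy, hlt⟩ := exists_card_defects_lt hN hB (j - i).val hd (ZMod.val_lt _) hx hi
        (by rwa [ZMod.natCast_zmod_val, add_sub_cancel])
      exact absurd (hmin y hy) (not_le.2 hlt)
    · intro x hx y hy
      rw [Set.mem_ofPred_eq] at hx hy
      have hyx : y ≠ x := fun h => hy (h ▸ hx)
      rw [P, Finset.sum_eq_zero, mul_zero]
      intro i _
      rw [if_neg hyx, add_zero]
      split_ifs with h
      · by_cases h1 : i ∈ defects x
        · by_cases h2 : i - 1 ∈ defects x
          · exact absurd ((card_defects_flip_lt hN h1 h2).le.trans hx) (h ▸ hy)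
          · exact absurd ((card_defects_flip_eq hN (by simp [h1, h2])).le.trans hx) (h ▸ hy)
        · by_cases h2 : i - 1 ∈ defects x
          · exact absurd ((card_defects_flip_eq hN (by simp [h1, h2])).le.trans hx) (h ▸ hy)
          · exact changeProb_eq_zero_of_no_defect h1 h2
      · rfl
    · intro x hx
      have hmod := card_defects_mod_two x
      rw [Set.mem_ofPred_eq] at hx
      -- A number at most 1 with the parity of `N` is `N % 2`.
      rw [sum_of_card_defects_le_one hN hx, ← hmod, Nat.mod_eq_of_lt (by lia)]
      ring
  obtain ⟨f, hf⟩ := hex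
  refine isMeanProfit_iff_of_poisson hp (f := fun x => f x - ones x) (fun x => ?_) μ
  have h1 : ∑ y, P N p x y * (f y - ones y) =
      ∑ y, P N p x y * f y - ∑ y, P N p x y * ones y := by
    rw [← Finset.sum_sub_distrib]
    exact Finset.sum_congr rfl fun y _ => by ring
  have h2 : meanPayoff p x = (N : ℝ)⁻¹ * ∑ i, (p (nbr x i) - 1 + ((x i).val : ℝ)) +
      (N : ℝ)⁻¹ * ∑ i, (p (nbr x i) - ((x i).val : ℝ)) := by
    rw [meanPayoff, ← mul_add, ← Finset.sum_add_distrib]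
    congr 1
    exact Finset.sum_congr rfl fun i _ => by ring
  rw [h1, sum_P_mul_ones, h2, hf x]
  ring

end GameB

/-! ### Game `C`: irreducibility, rotation invariance, balance of winners. -/

section GameC

variable {N : ℕ}

/-- A set of states closed under flips that contains one state contains all. -/
lemma mem_of_flip_closed [NeZero N] {B : Set (State N)} (hB : ∀ x ∈ B, ∀ i, flip x i ∈ B)
    {x : State N} (hx : x ∈ B) (y : State N) : y ∈ B := by
  classical
  -- Induction on a set `s` outside which the two states agree, correcting one site at a time.
  suffices ∀ (s : Finset (ZMod N)) (x : State N), x ∈ B → (∀ i ∉ s, x i = y i) → y ∈ B from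
    this Finset.univ x hx (by simp)
  intro s
  induction s using Finset.induction_on with
  | empty =>
    intro x hx h
    rwa [← show x = y from funext fun i => h i (by simp)]
  | insert a s ha ih =>
    intro x hx h
    by_cases hxa : x a = y a
    · refine ih x hx fun i hi => ?_
      by_cases hia : i = a
      · rw [hia, hxa]
      · exact h i (by simp [hia, hi])
    · refine ih (flip x a) (hB x hx a) fun i hi => ?_
      by_cases hia : i = a
      · rw [hia, flip_apply_self, one_sub_eq_iff]
        exact hxa
      · rw [flip_apply_of_ne x hia]
        exact h i (by simp [hia, hi])

lemma changeProb_pos {p : Fin 4 → ℝ} (hp : ∀ m, p m ∈ Set.Ioo (0 : ℝ) 1) (x : State N)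
    (i : ZMod N) : 0 < changeProb p x i := by
  unfold changeProb
  split_ifs
  · exact (hp _).1
  · exact sub_pos.2 (hp _).2

/-- Rotation of the circle of players. -/
def rotate (N : ℕ) : State N ≃ State N where
  toFun x i := x (i + 1)
  invFun x i := x (i - 1)
  left_inv x := by ext; simp
  right_inv x := by ext; simp

lemma rotate_apply (x : State N) (i : ZMod N) : rotate N x i = x (i + 1) := rfl

lemma flip_rotate (x : State N) (i : ZMod N) :
    flip (rotate N x) i = rotate N (flip x (i + 1)) := by
  ext j
  rw [rotate_apply]
  by_cases h : j = i
  · subst h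
    rw [flip_apply_self, flip_apply_self, rotate_apply]
  · rw [flip_apply_of_ne _ h, flip_apply_of_ne _ (by simpa using h), rotate_apply]

lemma nbr_rotate (x : State N) (i : ZMod N) : nbr (rotate N x) i = nbr x (i + 1) := by
  simp only [nbr, rotate_apply]
  congr 4
  ring_nf

variable [NeZero N] {p : Fin 4 → ℝ}

lemma P_rotate (x y : State N) : P N p (rotate N x) (rotate N y) = P N p x y := by
  simp only [P, flip_rotate, changeProb, stayProb, nbr_rotate, rotate_apply,
    EmbeddingLike.apply_eq_iff_eq]
  congr 1
  exact Equiv.sum_comp (Equiv.addRight (1 : ZMod N)) fun i =>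
    ((if y = flip x i then (if x i = 0 then p (nbr x i) else 1 - p (nbr x i)) else 0) +
      (if y = x then (if x i = 0 then 1 - p (nbr x i) else p (nbr x i)) else 0))

/-- Together with uniqueness, this makes the stationary law rotation invariant. -/
lemma IsStationary.rotate {π : State N → ℝ} (hπ : IsStationary (P N p) π) :
    IsStationary (P N p) fun x => π (rotate N x) where
  nonneg x := hπ.nonneg _
  sum_eq_one := ((Parrondo.rotate N).sum_comp π).trans hπ.sum_eq_one
  stationary := by
    ext y
    have := congrFun hπ.stationary (Parrondo.rotate N y)
    rw [← this]
    simp only [Matrix.vecMul, dotProduct]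
    conv_rhs => rw [← (Parrondo.rotate N).sum_comp]
    exact Finset.sum_congr rfl fun x _ => by rw [P_rotate]

lemma exists_unique_stationary_P (hp : ∀ m, p m ∈ Set.Ioo (0 : ℝ) 1) :
    (∃ π : State N → ℝ, IsStationary (P N p) π ∧
      ∀ π' : State N → ℝ, IsStationary (P N p) π' → π' = π) ∧
    ∀ g : State N → ℝ, ∃ (c : ℝ) (f : State N → ℝ),
      ∀ x, f x = g x - c + ∑ y, P N p x y * f y := by
  have hp' : ∀ m, p m ∈ Set.Icc (0 : ℝ) 1 := fun m => Set.Ioo_subset_Icc_self (hp m)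
  have hA : ∀ B : Set (State N), B.Nonempty → (0 : State N) ∉ B →
      ∃ x ∈ B, ∃ y ∉ B, 0 < P N p x y := by
    rintro B ⟨x, hx⟩ h0
    by_contra! hcon
    refine h0 (mem_of_flip_closed (fun x hx i => ?_) hx 0)
    by_contra hy
    exact absurd (hcon x hx _ hy) (not_le.2 (P_flip_pos hp' (changeProb_pos hp x i)))
  exact ⟨exists_unique_stationary (P_nonneg hp') sum_P 0 hA,
    exists_poisson (P_nonneg hp') sum_P 0 hA⟩

/-- Every flip can be undone with positive probability, so the zero set of `π` is closed under
flips; were it nonempty, it would be everything. -/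
lemma IsStationary.pos (hp : ∀ m, p m ∈ Set.Ioo (0 : ℝ) 1) {π : State N → ℝ}
    (hπ : IsStationary (P N p) π) (x : State N) : 0 < π x := by
  have hp' : ∀ m, p m ∈ Set.Icc (0 : ℝ) 1 := fun m => Set.Ioo_subset_Icc_self (hp m)
  refine lt_of_le_of_ne (hπ.nonneg x) fun hx => ?_
  have hall : ∀ y, y ∈ {y | π y = 0} := mem_of_flip_closed (fun y hy i => ?_) hx.symm
  · have : ∑ x, π x = 0 := Finset.sum_eq_zero fun y _ => hall y
    rw [hπ.sum_eq_one] at this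
    exact one_ne_zero this
  · have h1 := congrFun hπ.stationary y
    rw [Set.mem_ofPred_eq] at hy
    rw [hy] at h1
    have h2 := (Finset.sum_eq_zero_iff_of_nonneg
      fun z _ => mul_nonneg (hπ.nonneg z) (P_nonneg hp' z y)).1 h1 (flip y i) (Finset.mem_univ _)
    have h3 := P_flip_pos hp' (changeProb_pos hp (flip y i) i)
    rw [flip_flip] at h3
    exact (mul_eq_zero.1 h2).resolve_right h3.ne'

lemma eq_of_add_one_eq {c : ZMod N → ℝ} (h : ∀ i, c (i + 1) = c i) (i j : ZMod N) :
    c i = c j := by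
  have key : ∀ n : ℕ, c n = c 0 := fun n => by
    induction n with
    | zero => simp
    | succ n ih => rw [Nat.cast_succ, h, ih]
  have : ∀ i, c i = c 0 := fun i => by
    rw [← ZMod.natCast_zmod_val i]
    exact key _
  rw [this i, this j]

/-- Local functions have the same mean at all sites under a rotation invariant distribution. -/
lemma sum_mul_local_eq {π : State N → ℝ} (hrot : ∀ x, π (rotate N x) = π x)
    (G : Fin 2 → Fin 2 → ℝ) (i j : ZMod N) :
    ∑ x, π x * G (x (i - 1)) (x (i + 1)) = ∑ x, π x * G (x (j - 1)) (x (j + 1)) := by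
  refine eq_of_add_one_eq (c := fun i => ∑ x, π x * G (x (i - 1)) (x (i + 1))) (fun i => ?_) i j
  conv_rhs => rw [← (rotate N).sum_comp]
  refine Finset.sum_congr rfl fun x _ => ?_
  rw [hrot, rotate_apply, rotate_apply, sub_add_cancel, add_sub_cancel_right]

lemma gameC_mem_Ioo {q : ℝ} (hq : q ∈ Set.Ioo (0 : ℝ) 1) (m : Fin 4) :
    gameC ![1, q, q, 0] m ∈ Set.Ioo (0 : ℝ) 1 := by
  have h := gameB_mem_Icc hq m
  constructor <;> unfold gameC <;> linarith [h.1, h.2]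

/-- Mean payoff of game `C` under its stationary distribution. -/
lemma sum_mul_meanPayoff_gameC {q : ℝ} {π : State N → ℝ}
    (hπ : IsStationary (P N (gameC ![1, q, q, 0])) π) (hrot : ∀ x, π (rotate N x) = π x) :
    ∑ x, π x * meanPayoff (gameC ![1, q, q, 0]) x =
      2 / 3 * (2 * q - 1) * marginal13 π 0 1 := by
  let v : Fin 2 → ℝ := fun a => (a.val : ℝ)
  set m := marginal13 π 0 1 with hm
  set a := ∑ x, π x * v (x 0)
  have hsite : ∀ i, ∑ x, π x * v (x i) = a := fun i => by
    have := sum_mul_local_eq hrot (fun _ b => v b) (i - 1) (0 - 1)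
    simpa only [sub_add_cancel] using this
  have hpair : ∀ i : ZMod N, ∑ x, π x * ((1 - v (x (i - 1))) * v (x (i + 1))) = m := fun i => by
    rw [sum_mul_local_eq hrot (fun s t => (1 - v s) * v t) i 2, hm, marginal13]
    refine Finset.sum_congr rfl fun x _ => ?_
    have e1 : (2 : ZMod N) - 1 = 1 := by ring
    have e2 : (2 : ZMod N) + 1 = 3 := by ring
    rw [e1, e2]
    rcases fin_two_cases (x 1) with h | h <;> rcases fin_two_cases (x 3) with h' | h' <;>
      simp [h, h', v]
  have hlin : ∀ (i : ZMod N), ∑ x, π x * gameC ![1, q, q, 0] (nbr x i) =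
      3 / 4 - a / 2 + (q - 1 / 2) * m := fun i => by
    -- For neighbours `u`, `w`, the indicator of `u ≠ w` is `2 (1 - u) w + u - w`, and `u`, `w` have
    -- equal means.
    have hterm : ∀ x : State N, π x * gameC ![1, q, q, 0] (nbr x i) =
        3 / 4 * π x - 1 / 4 * (π x * v (x (i - 1))) - 1 / 4 * (π x * v (x (i + 1))) +
          (q - 1 / 2) / 2 * (2 * (π x * ((1 - v (x (i - 1))) * v (x (i + 1)))) +
            (π x * v (x (i - 1)) - π x * v (x (i + 1)))) := by
      intro x
      rcases fin_two_cases (x (i - 1)) with h | h <;>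
        rcases fin_two_cases (x (i + 1)) with h' | h' <;>
        simp [gameC, nbr, h, h', v] <;> ring
    simp_rw [hterm]
    simp only [Finset.sum_add_distrib, Finset.sum_sub_distrib, ← Finset.mul_sum,
      hπ.sum_eq_one, hsite, hpair]
    ring
  -- `-ones` solves the Poisson equation for its own drift with constant 0, so the stationary drift
  -- vanishes.
  have hdrift : ∑ x, π x * ((N : ℝ)⁻¹ * ∑ i, (gameC ![1, q, q, 0] (nbr x i) - v (x i))) = 0 := by
    refine (hπ.poisson_const (f := fun x => - ones x) fun x => ?_).symm
    simp only [mul_neg, Finset.sum_neg_distrib]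
    rw [sum_P_mul_ones]
    ring
  have hcomm : ∀ h : ZMod N → State N → ℝ, ∑ x, π x * ((N : ℝ)⁻¹ * ∑ i, h i x) =
      (N : ℝ)⁻¹ * ∑ i, ∑ x, π x * h i x := fun h => by
    simp only [Finset.mul_sum]
    rw [Finset.sum_comm]
    exact Finset.sum_congr rfl fun _ _ => Finset.sum_congr rfl fun _ _ => by ring
  rw [hcomm fun i x => gameC ![1, q, q, 0] (nbr x i) - v (x i)] at hdrift
  simp only [mul_sub, Finset.sum_sub_distrib, hlin, hsite, inv_mul_sum_const] at hdrift
  have hpay : ∀ i : ZMod N, ∑ x, π x * (2 * gameC ![1, q, q, 0] (nbr x i) - 1) =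
      2 * (3 / 4 - a / 2 + (q - 1 / 2) * m) - 1 := fun i => by
    rw [← hlin i, Finset.mul_sum]
    conv_rhs => enter [2]; rw [← hπ.sum_eq_one]
    rw [← Finset.sum_sub_distrib]
    exact Finset.sum_congr rfl fun x _ => by ring
  simp only [meanPayoff]
  rw [hcomm fun i x => 2 * gameC ![1, q, q, 0] (nbr x i) - 1]
  simp only [hpay]
  rw [inv_mul_sum_const]
  linarith

lemma marginal13_pos (hN : 3 ≤ N) {π : State N → ℝ} (hπ : ∀ x, 0 < π x) :
    0 < marginal13 π 0 1 := by
  classical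
  have h31 : (3 : ZMod N) ≠ 1 := fun h => by
    have h2 : ((2 : ℕ) : ZMod N) = 0 := by
      have : (3 : ZMod N) - 1 = 0 := sub_eq_zero.2 h
      rw [← this]
      norm_num
    rw [ZMod.natCast_eq_zero_iff] at h2
    exact absurd (Nat.le_of_dvd two_pos h2) (by lia)
  refine Finset.sum_pos' (fun x _ => ?_)
    -- Player 3 is the only winner; `N ≥ 3` keeps him distinct from player 1.
    ⟨Function.update 0 3 1, Finset.mem_univ _, ?_⟩
  · split_ifs
    exacts [(hπ x).le, le_rfl]
  · rw [if_pos]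
    · exact hπ _
    · simp [h31.symm]

/-- Stationary distribution and mean profit of game `C`. -/
lemma gameC_stationary_and_meanProfit (hN : 3 ≤ N) {q : ℝ} (hq : q ∈ Set.Ioo (1 / 2 : ℝ) 1) :
    ∃ π : State N → ℝ, IsStationary (P N (gameC ![1, q, q, 0])) π ∧
      (∀ π' : State N → ℝ, IsStationary (P N (gameC ![1, q, q, 0])) π' → π' = π) ∧
      (∀ μ : ℝ, IsMeanProfit N (gameC ![1, q, q, 0]) μ ↔
        μ = 2 / 3 * (2 * q - 1) * marginal13 π 0 1) ∧
      0 < 2 / 3 * (2 * q - 1) * marginal13 π 0 1 := by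
  have hp := gameC_mem_Ioo (q := q) ⟨by linarith [hq.1], hq.2⟩
  obtain ⟨⟨π, hπ, huniq⟩, hpoisson⟩ := exists_unique_stationary_P (N := N) hp
  refine ⟨π, hπ, huniq, fun μ => ?_, ?_⟩
  · obtain ⟨c, f, hf⟩ := hpoisson (meanPayoff (gameC ![1, q, q, 0]))
    rw [isMeanProfit_iff_of_poisson (fun m => Set.Ioo_subset_Icc_self (hp m)) hf,
      hπ.poisson_const hf, sum_mul_meanPayoff_gameC hπ (congrFun (huniq _ hπ.rotate))]
  · have h1 : 0 < 2 * q - 1 := by linarith [hq.1]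
    have h2 := marginal13_pos hN (hπ.pos hp)
    positivity

end GameC

end Parrondo

/-- `∀ μ, IsMeanProfit N p μ ↔ μ = a` says that the mean profit per turn exists, is unique,
and equals `a`. -/
theorem mainTheorem1 (p₁ p₂ : ℝ) (h₁₂ : p₁ = p₂) (h₁ : p₁ ∈ Set.Ioo (1 / 2 : ℝ) 1)
    (N : ℕ) [NeZero N] (hN : 3 ≤ N) :
    (Even N → ∀ μ : ℝ, Parrondo.IsMeanProfit N ![1, p₁, p₂, 0] μ ↔ μ = 0) ∧
    (Odd N →
      (∀ μ : ℝ, Parrondo.IsMeanProfit N ![1, p₁, p₂, 0] μ ↔ μ = (p₁ + p₂ - 1) / N) ∧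
        0 < (p₁ + p₂ - 1) / N) ∧
    (∃ π : Parrondo.State N → ℝ,
      Parrondo.IsStationary (Parrondo.P N (Parrondo.gameC ![1, p₁, p₂, 0])) π ∧
      (∀ π' : Parrondo.State N → ℝ,
        Parrondo.IsStationary (Parrondo.P N (Parrondo.gameC ![1, p₁, p₂, 0])) π' → π' = π) ∧
      (∀ μ : ℝ, Parrondo.IsMeanProfit N (Parrondo.gameC ![1, p₁, p₂, 0]) μ ↔
        μ = 2 / 3 * (2 * p₁ - 1) * Parrondo.marginal13 π 0 1) ∧
      0 < 2 / 3 * (2 * p₁ - 1) * Parrondo.marginal13 π 0 1) ∧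
    (Parrondo.ParrondoEffect N ![1, p₁, p₂, 0] ↔ Even N) := by
  subst h₁₂
  have hB := Parrondo.isMeanProfit_gameB_iff (N := N) (q := p₁) (by lia)
    ⟨by linarith [h₁.1], h₁.2⟩
  have hN0 : (0 : ℝ) < N := Nat.cast_pos.2 (by lia)
  have heven : Even N → ∀ μ : ℝ, Parrondo.IsMeanProfit N ![1, p₁, p₁, 0] μ ↔ μ = 0 := by
    intro h μ
    rw [hB, Nat.even_iff.1 h]
    simp
  have hodd : Odd N → ∀ μ : ℝ, Parrondo.IsMeanProfit N ![1, p₁, p₁, 0] μ ↔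
      μ = (p₁ + p₁ - 1) / N := by
    intro h μ
    rw [hB, Nat.odd_iff.1 h, Nat.cast_one, one_mul, two_mul]
  have hpos : 0 < (p₁ + p₁ - 1) / N := div_pos (by linarith [h₁.1]) hN0
  obtain ⟨π, hπ, huniq, hC, hCpos⟩ := Parrondo.gameC_stationary_and_meanProfit hN h₁
  refine ⟨heven, fun h => ⟨hodd h, hpos⟩, ⟨π, hπ, huniq, hC, hCpos⟩, fun h => ?_, fun h => ?_⟩
  · obtain ⟨μB, μC, h1, -, h2, -⟩ := h
    by_contra hne
    rw [hodd (Nat.not_even_iff_odd.1 hne)] at h1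
    linarith
  · exact ⟨0, _, (heven h 0).2 rfl, (hC _).2 rfl, le_rfl, hCpos⟩
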